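/- For integers $k\ge 2$, $N\ge 1$ let $K^k_N$ be the complete $k$-uniform hypergraph on the ordered vertex set $\{1,\dots,N\}$, whose edges are all $k$-element subsets. For vertices $x_1<x_2<\cdots<x_{n+k-1}$, the $n$ edges $\{x_i,x_{i+1},\dots,x_{i+k-1}\}$, $1\le i\le n$, are said to form a monotone path of length $n$. Let $N_k(q,n)$ be the smallest integer $N$ such that every coloring of the edges of $K^k_N$ with $q$ colors contains a monochromatic monotone path of length $n$. For real $x$ let $t_1(x)=x$ and $t_{k+1}(x)=2^{t_k(x)}$ for $k\ge 1$. There is an absolute constant $n_0$ such that for all integers $k\ge 3$, $q\ge 2$ and $n\ge n_0$, $$t_{k-1}\!\left(\frac{n^{q-1}}{2\sqrt q}\right)\;\le\; N_k(q,n)\;\le\; t_{k-1}\!\left(2n^{q-1}\right).$$ -/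

import Mathlib

/-- The edges of the complete `k`-uniform hypergraph on the ordered vertex set `Fin N`. -/
abbrev HyperEdge (k N : ℕ) : Type := {e : Finset (Fin N) // e.card = k}

/-- The `i`-th edge `{x_i, x_{i+1}, …, x_{i+k-1}}` of the monotone path of length `n`
(that is, with `n` edges) on the vertices `x_0 < x_1 < ⋯ < x_{n+k-2}`. -/
def monotonePathEdge {k n N : ℕ} (x : Fin (n + k - 1) ↪o Fin N) (i : Fin n) :
    HyperEdge k N :=
  ⟨Finset.univ.map
      ⟨fun j : Fin k => x ⟨i.val + j.val, by omega⟩, fun a b h => by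
        have h' := congrArg Fin.val (x.injective h)
        simp only at h'
        exact Fin.ext (by omega)⟩,
    by simp⟩

/-- The colouring `c` of the edges of the complete `k`-uniform hypergraph contains a
monochromatic monotone path of length `n`. -/
def HasMonochromaticMonotonePath {k q N : ℕ} (c : HyperEdge k N → Fin q) (n : ℕ) : Prop :=
  ∃ (x : Fin (n + k - 1) ↪o Fin N) (a : Fin q), ∀ i : Fin n, c (monotonePathEdge x i) = a

/-- `N_k(q,n)`: the smallest `N` such that every `q`-colouring of the edges of the complete
`k`-uniform hypergraph on `N` ordered vertices contains a monochromatic monotone path of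
length `n`. (The value would be `0` if there were no such `N`; a positive lower bound on it
thus includes the existence of such an `N`.) -/
noncomputable def monotonePathRamsey (k q n : ℕ) : ℕ :=
  sInf {N : ℕ | ∀ c : HyperEdge k N → Fin q, HasMonochromaticMonotonePath c n}

/-- `t_k(x)`: the tower of `k - 1` twos with `x` at the top, so that `t_1(x) = x` and
`t_{k+1}(x) = 2 ^ t_k(x)`. -/
noncomputable def tower (k : ℕ) (x : ℝ) : ℝ :=
  (fun y : ℝ => (2 : ℝ) ^ y)^[k - 1] x

/-!
For `n ≥ 1` the Ramsey number `monotonePathRamsey k q n` is exactly one more than the number of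
elements of the poset obtained from the grid `P = [n]^q` by passing `k - 2` times to the lattice of
lower sets (`monotonePathRamsey_eq`). A coloring of the `k`-subsets of an ordered set without a
monochromatic monotone path of length `n` assigns to each increasing `(k - 1)`-tuple the vector of
the lengths of the longest monochromatic paths ending there, a point of `P`; along each edge the
coordinate of its color increases, so that the vector does not go weakly down. Such shift maps on
`(m + 1)`-tuples with values in `P` correspond to shift maps on `m`-tuples with values in the
lower sets of `P` (`existsShiftMap_succ_iff`), and shift maps on single vertices exist exactly up to
the number of elements of the poset.

For the upper bound, the grid is cut into `n^(q-2)` squares, each of which has fewer than `4^n`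
lower sets, so that `[n]^q` has fewer than `2^(2n^(q-1))` lower sets (`card_lowerSet_grid_lt`).
Each further step at most exponentiates the number of elements.

For the lower bound, Chebyshev's inequality for the coordinate sum yields an antichain of the grid
with about `(2/3) n^(q-1) / √q` elements (`exists_large_layer`). An antichain with `w` elements in
a poset gives one with `w.choose (w / 2)` elements in the lattice of lower sets
(`exists_antichain_lowerSet`). The constant `2/3` exceeds the required `1/2` by enough to
absorb, at every level, the factor lost between `2 ^ w` and the binomial coefficient
(`two_rpow_le_choose_middle`); hence the threshold for `n` depends on neither `k` nor `q`.
-/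

/-! ### Shift maps on increasing tuples -/

/-- A shift map of level `m` on `N` ordered vertices with values in `P`: an assignment `f` of
elements of `P` to the increasing `m`-tuples such that moving one step forward along an increasing
`(m + 1)`-tuple never goes weakly down in `P`. It is a homomorphism from the shift graph
on `m`-tuples to the relation `¬ · ≥ ·` on `P`; the values of `f` at tuples that are not increasing
are irrelevant. -/
def ExistsShiftMap (m N : ℕ) (P : Type) [Preorder P] : Prop :=
  ∃ f : (Fin m → Fin N) → P, ∀ x : Fin (m + 1) → Fin N, StrictMono x →
    ¬ f (Fin.tail x) ≤ f (Fin.init x)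

lemma strictMono_tail {m N : ℕ} {x : Fin (m + 1) → Fin N} (hx : StrictMono x) :
    StrictMono (Fin.tail x) := fun _ _ h => hx (Fin.succ_lt_succ_iff.2 h)

lemma strictMono_init {m N : ℕ} {x : Fin (m + 1) → Fin N} (hx : StrictMono x) :
    StrictMono (Fin.init x) := fun _ _ h => hx (Fin.castSucc_lt_castSucc_iff.2 h)

/-- Two increasing tuples overlapping in all but the first entry of one and the last entry of the
other are the two ends of a longer increasing tuple. -/
lemma exists_strictMono_init_tail {m N : ℕ} {w x : Fin (m + 2) → Fin N} (hw : StrictMono w)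
    (hx : StrictMono x) (h : Fin.tail w = Fin.init x) :
    ∃ z : Fin (m + 3) → Fin N, StrictMono z ∧ Fin.init z = w ∧ Fin.tail z = x := by
  have htail : Fin.tail (Fin.cons (w 0) x : Fin (m + 3) → Fin N) = x := Fin.tail_cons _ _
  refine ⟨Fin.cons (w 0) x, ?_, ?_, htail⟩
  · refine Fin.strictMono_iff_lt_succ.2 fun i => ?_
    refine Fin.cases ?_ (fun j => ?_) i
    · have h0 : w 1 = x 0 := congrFun h 0
      simpa [← h0] using hw (show (0 : Fin (m + 2)) < 1 by simp)
    · rw [← Fin.succ_castSucc, Fin.cons_succ, Fin.cons_succ]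
      exact hx Fin.castSucc_lt_succ
  · funext i
    refine Fin.cases rfl (fun j => ?_) i
    have hj : w j.succ = x j.castSucc := congrFun h j
    rw [Fin.init, ← Fin.succ_castSucc, Fin.cons_succ, hj]

/-- The arc construction on shift graphs is left adjoint to passing from a poset to its lower sets:
a shift map `f` on `(m + 2)`-tuples yields the lower sets generated by the values of `f` on the
tuples ending in a given `(m + 1)`-tuple, and conversely an element witnessing
`¬ g (tail x) ⊆ g (init x)` is a suitable value at `x`. -/
lemma existsShiftMap_succ_iff (m N : ℕ) (P : Type) [Preorder P] [Nonempty P] :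
    ExistsShiftMap (m + 2) N P ↔ ExistsShiftMap (m + 1) N (LowerSet P) := by
  constructor
  · rintro ⟨f, hf⟩
    refine ⟨fun y => lowerClosure {p | ∃ w, StrictMono w ∧ Fin.tail w = y ∧ f w = p},
      fun x hx hle => ?_⟩
    have hmem := hle (subset_lowerClosure (⟨x, hx, rfl, rfl⟩ :
      f x ∈ {p | ∃ w, StrictMono w ∧ Fin.tail w = Fin.tail x ∧ f w = p}))
    obtain ⟨_, ⟨w, hw, hwx, rfl⟩, hxw⟩ := hmem
    obtain ⟨z, hz, rfl, rfl⟩ := exists_strictMono_init_tail hw hx hwx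
    exact hf z hz hxw
  · rintro ⟨g, hg⟩
    have key : ∀ x : Fin (m + 2) → Fin N, ∃ p : P, StrictMono x →
        p ∈ g (Fin.tail x) ∧ p ∉ g (Fin.init x) := by
      intro x
      by_cases hx : StrictMono x
      · obtain ⟨p, hp, hp'⟩ := Set.not_subset.1 (hg x hx)
        exact ⟨p, fun _ => ⟨hp, hp'⟩⟩
      · exact ⟨Classical.arbitrary P, fun h => absurd h hx⟩
    choose f hf using key
    refine ⟨f, fun z hz hle => ?_⟩
    have h1 := (hf _ (strictMono_tail hz)).2
    have h2 := (hf _ (strictMono_init hz)).1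
    exact h1 ((g _).lower hle h2)

/-- On single vertices a shift map is an injective sequence listed along a linear extension. -/
lemma existsShiftMap_one_iff (N : ℕ) (P : Type) [PartialOrder P] [Finite P] :
    ExistsShiftMap 1 N P ↔ N ≤ Nat.card P := by
  have := Fintype.ofFinite P
  constructor
  · rintro ⟨f, hf⟩
    have hlt : ∀ i j : Fin N, i < j → f (fun _ => i) ≠ f (fun _ => j) := by
      intro i j hij he
      have hmono : StrictMono ![i, j] := by
        refine Fin.strictMono_iff_lt_succ.2 fun t => ?_
        fin_cases t
        simpa using hij
      refine hf ![i, j] hmono ?_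
      have h1 : Fin.tail ![i, j] = fun _ => j := by
        funext t; fin_cases t; rfl
      have h2 : Fin.init ![i, j] = fun _ => i := by
        funext t; fin_cases t; rfl
      rw [h1, h2, he]
    have hinj : Function.Injective fun i : Fin N => f (fun _ => i) := by
      intro i j he
      rcases lt_trichotomy i j with h | h | h
      · exact absurd he (hlt i j h)
      · exact h
      · exact absurd he.symm (hlt j i h)
    simpa using Nat.card_le_card_of_injective _ hinj
  · intro hN
    have : Fintype (LinearExtension P) := inferInstanceAs (Fintype P)
    have hcard : Fintype.card (LinearExtension P) = Nat.card P := by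
      rw [Nat.card_eq_fintype_card]
      exact Fintype.card_congr (α := LinearExtension P) (Equiv.refl P)
    let e : Fin (Nat.card P) ≃o LinearExtension P := Fintype.orderIsoFinOfCardEq _ hcard
    refine ⟨fun x => (e (Fin.castLE hN (x 0)) : P), fun x hx hle => ?_⟩
    have hle' := (toLinearExtension (α := P)).monotone hle
    have hle'' : e (Fin.castLE hN (x 1)) ≤ e (Fin.castLE hN (x 0)) := hle'
    rw [e.le_iff_le] at hle''
    have hlt : x 0 < x 1 := hx (by simp)
    have : (x 1).val ≤ (x 0).val := hle''
    exact absurd hlt (not_lt.2 this)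

/-- The number of elements of the poset obtained from `P` by passing `m` times to the lattice of
lower sets. -/
noncomputable def iterLowerSetCard : (m : ℕ) → (P : Type) → [Preorder P] → ℕ
  | 0, P, _ => Nat.card P
  | m + 1, P, _ => iterLowerSetCard m (LowerSet P)

instance lowerSet_finite (P : Type) [Preorder P] [Finite P] : Finite (LowerSet P) :=
  Finite.of_injective (fun s : LowerSet P => (s : Set P)) SetLike.coe_injective

lemma existsShiftMap_iff (m N : ℕ) (P : Type) [PartialOrder P] [Finite P] [Nonempty P] :
    ExistsShiftMap (m + 1) N P ↔ N ≤ iterLowerSetCard m P := by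
  induction m generalizing P with
  | zero => exact existsShiftMap_one_iff N P
  | succ m ih =>
    rw [existsShiftMap_succ_iff, ih]
    rfl

/-! ### Colorings without monochromatic monotone paths -/

/-- The hyperedge with the vertices of an increasing tuple. -/
def tupleEdge {k N : ℕ} (x : Fin k → Fin N) (hx : StrictMono x) : HyperEdge k N :=
  ⟨Finset.univ.map ⟨x, hx.injective⟩, by simp⟩

/-- In the coloring `c`, a monotone path of `l` edges of color `a` ends in the `m`-tuple `y`. -/
def PathEndsAt {m q N : ℕ} (c : HyperEdge (m + 1) N → Fin q) (a : Fin q) :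
    ℕ → (Fin m → Fin N) → Prop
  | 0, _ => True
  | l + 1, y => ∃ (x : Fin (m + 1) → Fin N) (hx : StrictMono x),
      Fin.tail x = y ∧ c (tupleEdge x hx) = a ∧ PathEndsAt c a l (Fin.init x)

/-- The vertices of a monochromatic path are kept as the values of a function on `ℕ`
at the arguments below `l + m`. -/
lemma PathEndsAt.exists_vertices {m q N : ℕ} {c : HyperEdge (m + 1) N → Fin q} {a : Fin q}
    (hm : 0 < m) {l : ℕ} {y : Fin m → Fin N} (hy : StrictMono y) (h : PathEndsAt c a l y) :
    ∃ z : ℕ → Fin N, (∀ i j, i < j → j < l + m → z i < z j) ∧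
      (∀ j : Fin m, z (l + j) = y j) ∧
      ∀ i < l, ∃ hx : StrictMono fun j : Fin (m + 1) => z (i + j), c (tupleEdge _ hx) = a := by
  induction l generalizing y with
  | zero =>
    refine ⟨fun i => if h : i < m then y ⟨i, h⟩ else y ⟨0, hm⟩, ?_, ?_, by simp⟩
    · intro i j hij hj
      have hj' : j < m := by omega
      have hi' : i < m := by omega
      simp only [hi', hj', dif_pos]
      exact hy hij
    · intro j
      simp
  | succ l ih =>
    obtain ⟨x, hx, rfl, hc, hp⟩ := h
    obtain ⟨z, hz, hzy, hzc⟩ := ih (strictMono_init hx) hp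
    have hold : ∀ i, i < l + m → Function.update z (l + m) (x (Fin.last m)) i = z i :=
      fun i hi => Function.update_of_ne (by omega) _ _
    have hxz : ∀ j : Fin (m + 1),
        Function.update z (l + m) (x (Fin.last m)) (l + j) = x j := by
      intro j
      refine Fin.lastCases ?_ (fun j => ?_) j
      · simp
      · rw [Fin.val_castSucc, hold _ (by omega), hzy]
        rfl
    refine ⟨Function.update z (l + m) (x (Fin.last m)), ?_, ?_, ?_⟩
    · intro i j hij hj
      rw [hold i (by omega)]
      by_cases hjm : j < l + m
      · rw [hold j hjm]
        exact hz i j hij hjm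
      · obtain rfl : j = l + m := by omega
        rw [Function.update_self]
        have hlast : z (l + m - 1) < x (Fin.last m) := by
          have h1 := hzy ⟨m - 1, by omega⟩
          have h2 : l + (m - 1) = l + m - 1 := by omega
          simp only [h2] at h1
          rw [h1]
          exact hx (Fin.castSucc_lt_last _)
        rcases Nat.lt_or_ge i (l + m - 1) with hi | hi
        · exact (hz i _ hi (by omega)).trans hlast
        · obtain rfl : i = l + m - 1 := by omega
          exact hlast
    · intro j
      have := hxz j.succ
      rw [Fin.val_succ] at this
      rw [show l + 1 + (j : ℕ) = l + (j + 1) by omega, this]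
      rfl
    · intro i hi
      rcases Nat.lt_succ_iff_lt_or_eq.1 hi with hi | rfl
      · have hfun : (fun j : Fin (m + 1) =>
            Function.update z (l + m) (x (Fin.last m)) (i + j)) =
            fun j : Fin (m + 1) => z (i + j) :=
          funext fun j => hold _ (by omega)
        simp only [hfun]
        exact hzc i hi
      · have hfun : (fun j : Fin (m + 1) =>
            Function.update z (i + m) (x (Fin.last m)) (i + j)) = x := funext hxz
        simp only [hfun]
        exact ⟨hx, hc⟩

lemma PathEndsAt.hasMonochromaticMonotonePath {m q N n : ℕ} {c : HyperEdge (m + 1) N → Fin q}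
    {a : Fin q} (hm : 0 < m) {y : Fin m → Fin N} (hy : StrictMono y) (h : PathEndsAt c a n y) :
    HasMonochromaticMonotonePath c n := by
  obtain ⟨z, hz, -, hzc⟩ := h.exists_vertices hm hy
  refine ⟨OrderEmbedding.ofStrictMono (fun i : Fin (n + (m + 1) - 1) => z i) ?_, a, fun i => ?_⟩
  · intro i j hij
    exact hz i j hij (by omega)
  · obtain ⟨hx, hc⟩ := hzc i i.isLt
    rw [← hc]
    rfl

/-- Recording, for each color, the length of the longest path of that color ending in a given tuple
turns a coloring without long monochromatic paths into a shift map. Conversely, a shift map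
colors each edge by a coordinate that increases along it, and a coordinate with `n` values cannot
increase `n` times. -/
lemma exists_coloring_iff {m q N n : ℕ} (hm : 0 < m) (hn : 0 < n) :
    (∃ c : HyperEdge (m + 1) N → Fin q, ¬ HasMonochromaticMonotonePath c n) ↔
      ExistsShiftMap m N (Fin q → Fin n) := by
  classical
  constructor
  · rintro ⟨c, hc⟩
    refine ⟨fun y a => ⟨Nat.findGreatest (fun l => PathEndsAt c a l y) (n - 1),
      (Nat.findGreatest_le _).trans_lt (by omega)⟩, fun x hx hle => ?_⟩
    have hle' := hle (c (tupleEdge x hx))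
    rw [Fin.mk_le_mk] at hle'
    have hspec := Nat.findGreatest_spec
      (P := fun l => PathEndsAt c (c (tupleEdge x hx)) l (Fin.init x)) (Nat.zero_le (n - 1)) trivial
    set l := Nat.findGreatest
      (fun l => PathEndsAt c (c (tupleEdge x hx)) l (Fin.init x)) (n - 1) with hl
    have hnext : PathEndsAt c (c (tupleEdge x hx)) (l + 1) (Fin.tail x) :=
      ⟨x, hx, rfl, rfl, hspec⟩
    have hln : l ≤ n - 1 := Nat.findGreatest_le _
    rcases Nat.lt_or_ge l (n - 1) with h | h
    · have := Nat.le_findGreatest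
        (P := fun l => PathEndsAt c (c (tupleEdge x hx)) l (Fin.tail x)) (Nat.succ_le_of_lt h) hnext
      exact absurd (this.trans hle') (by omega)
    · obtain hln' : l + 1 = n := by omega
      rw [hln'] at hnext
      exact hc (hnext.hasMonochromaticMonotonePath hm (strictMono_tail hx))
  · rintro ⟨f, hf⟩
    have key : ∀ e : HyperEdge (m + 1) N, ∃ a : Fin q,
        f (Fin.init (e.1.orderEmbOfFin e.2)) a < f (Fin.tail (e.1.orderEmbOfFin e.2)) a := by
      intro e
      have h := hf (e.1.orderEmbOfFin e.2) (e.1.orderEmbOfFin e.2).strictMono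
      rw [Pi.le_def] at h
      push Not at h
      exact h
    choose c hc using key
    refine ⟨c, ?_⟩
    rintro ⟨x, a, hx⟩
    -- `y i` is the `i`-th window of `m` consecutive vertices of the path, `0 ≤ i ≤ n`
    let y : Fin (n + 1) → Fin m → Fin N := fun i j => x ⟨i + j, by omega⟩
    have hstep : ∀ i : Fin n, f (y i.castSucc) a < f (y i.succ) a := by
      intro i
      have h := hc (monotonePathEdge x i)
      have hw : (fun j : Fin (m + 1) => x ⟨i.val + j.val, by omega⟩) =
          (monotonePathEdge x i).1.orderEmbOfFin (monotonePathEdge x i).2 := by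
        refine Finset.orderEmbOfFin_unique _ (fun j => ?_) (fun j j' hj => ?_)
        · simp only [monotonePathEdge, Finset.mem_map, Finset.mem_univ, true_and]
          exact ⟨j, rfl⟩
        · refine x.strictMono ?_
          simpa using hj
      rw [← hw, hx i] at h
      have hsucc : y i.succ = Fin.tail fun j : Fin (m + 1) => x ⟨i.val + j.val, by omega⟩ := by
        funext j
        refine congrArg x (Fin.ext ?_)
        simp only [Fin.val_succ]
        omega
      rw [hsucc]
      exact h
    have hmono : StrictMono fun i => f (y i) a := Fin.strictMono_iff_lt_succ.2 hstep
    have := Fintype.card_le_of_injective _ hmono.injective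
    simp at this

/-- The Ramsey number of monotone paths is one more than the number of elements of the
`(k - 2)`-fold lattice of lower sets over the grid `[n]^q`. -/
theorem monotonePathRamsey_eq (m q n : ℕ) (hn : 0 < n) :
    monotonePathRamsey (m + 2) q n = iterLowerSetCard m (Fin q → Fin n) + 1 := by
  have : Nonempty (Fin q → Fin n) := ⟨fun _ => ⟨0, hn⟩⟩
  have hset : {N : ℕ | ∀ c : HyperEdge (m + 2) N → Fin q, HasMonochromaticMonotonePath c n} =
      Set.Ici (iterLowerSetCard m (Fin q → Fin n) + 1) := by
    ext N
    have h := (exists_coloring_iff (q := q) (N := N) m.succ_pos hn).trans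
      (existsShiftMap_iff m N (Fin q → Fin n))
    rw [Set.mem_ofPred_eq, Set.mem_Ici, Nat.succ_le_iff, ← not_le, ← h]
    push Not
    rfl
  rw [monotonePathRamsey, hset, csInf_Ici]

/-! ### Upper bounds for numbers of lower sets -/

lemma card_lowerSet_le_two_pow (P : Type) [Preorder P] [Finite P] :
    Nat.card (LowerSet P) ≤ 2 ^ Nat.card P := by
  have := Fintype.ofFinite P
  have h := Nat.card_le_card_of_injective (fun s : LowerSet P => (s : Set P))
    SetLike.coe_injective
  simpa [Nat.card_eq_fintype_card, Fintype.card_set] using h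

/-- The summand `1` survives the recursion since `2 ^ a + 1 ≤ 2 ^ (a + 1)`. -/
lemma iterLowerSetCard_add_one_le (m : ℕ) (P : Type) [PartialOrder P] [Finite P] {t : ℝ}
    (ht : (Nat.card P : ℝ) + 1 ≤ t) :
    (iterLowerSetCard m P : ℝ) + 1 ≤ (fun y : ℝ => (2 : ℝ) ^ y)^[m] t := by
  induction m generalizing P t with
  | zero => exact ht
  | succ m ih =>
    rw [Function.iterate_succ_apply]
    refine ih (LowerSet P) ?_
    have h1 : (Nat.card (LowerSet P) : ℝ) ≤ 2 ^ Nat.card P := by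
      exact_mod_cast card_lowerSet_le_two_pow P
    have h2 : (1 : ℝ) ≤ 2 ^ Nat.card P := one_le_pow₀ (by norm_num)
    calc (Nat.card (LowerSet P) : ℝ) + 1 ≤ 2 ^ Nat.card P * 2 := by linarith
      _ = (2 : ℝ) ^ ((Nat.card P : ℝ) + 1) := by
        rw [Real.rpow_add two_pos, Real.rpow_natCast, Real.rpow_one]
      _ ≤ (2 : ℝ) ^ t := Real.rpow_le_rpow_of_exponent_le (by norm_num) ht

open Classical in
/-- A lower set of `Fin n` is the initial segment with as many elements. -/
lemma mem_iff_lt_card_of_isLowerSet {n : ℕ} {s : Set (Fin n)} (hs : IsLowerSet s) (j : Fin n) :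
    j ∈ s ↔ j.val < (Finset.univ.filter (· ∈ s)).card := by
  constructor
  · intro hj
    have hsub : Finset.Iic j ⊆ Finset.univ.filter (· ∈ s) := by
      intro i hi
      simpa using hs (Finset.mem_Iic.1 hi) hj
    have := Finset.card_le_card hsub
    rw [Fin.card_Iic] at this
    omega
  · intro hlt
    by_contra hj
    have hsub : Finset.univ.filter (· ∈ s) ⊆ Finset.Iio j := by
      intro i hi
      rw [Finset.mem_Iio]
      by_contra hij
      exact hj (hs (not_lt.1 hij) (by simpa using hi))
    have := Finset.card_le_card hsub
    rw [Fin.card_Iio] at this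
    omega

/-- A lower set of the square is encoded by its boundary, a lattice path with `2 * n` steps:
the set of the `n` positions of the steps in one of the two directions determines it, and this set
is never empty. -/
lemma card_lowerSet_square_lt {n : ℕ} (hn : 0 < n) :
    Nat.card (LowerSet (Fin n × Fin n)) < 4 ^ n := by
  classical
  have := Fintype.ofFinite (LowerSet (Fin n × Fin n))
  let col : LowerSet (Fin n × Fin n) → Fin n → Finset (Fin n) := fun D i =>
    Finset.univ.filter (· ∈ {j : Fin n | (i.rev, j) ∈ D})
  have hcol : ∀ D i, (col D i).card ≤ n := fun D i => by
    simpa using Finset.card_le_univ (col D i)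
  let g : LowerSet (Fin n × Fin n) → Fin n → Fin (2 * n) := fun D i =>
    ⟨i + (col D i).card, by have := hcol D i; omega⟩
  have hg : ∀ D, StrictMono (g D) := by
    intro D i j hij
    have hsub : col D i ⊆ col D j := by
      intro t ht
      simp only [col, Set.mem_ofPred_eq, Finset.mem_filter, Finset.mem_univ, true_and] at ht ⊢
      exact D.lower (show (j.rev, t) ≤ (i.rev, t) from
        ⟨Fin.rev_le_rev.2 hij.le, le_rfl⟩) ht
    have := Finset.card_le_card hsub
    have hij' : i.val < j.val := hij
    simp only [g, Fin.mk_lt_mk]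
    omega
  have hinj : Function.Injective fun D => Finset.univ.image (g D) := by
    intro D E h
    have hrange : Set.range (g D) = Set.range (g E) := by
      have := congrArg (fun s : Finset (Fin (2 * n)) => (s : Set (Fin (2 * n)))) h
      simpa using this
    have hgDE := (StrictMono.range_inj (hg D) (hg E)).1 hrange
    ext ⟨i, j⟩
    have hlow : ∀ F : LowerSet (Fin n × Fin n), IsLowerSet {j : Fin n | (i, j) ∈ F} :=
      fun F a b hab ha => F.lower (show (i, b) ≤ (i, a) from ⟨le_rfl, hab⟩) ha
    have hmem : ∀ F, (i, j) ∈ F ↔ j.val < (col F i.rev).card := by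
      intro F
      have := mem_iff_lt_card_of_isLowerSet (hlow F) j
      simpa [col] using this
    have hi : i.rev.val + (col D i.rev).card = i.rev.val + (col E i.rev).card :=
      congrArg Fin.val (congrFun hgDE i.rev)
    change (i, j) ∈ D ↔ (i, j) ∈ E
    rw [hmem, hmem, Nat.add_left_cancel hi]
  have hne : (∅ : Finset (Fin (2 * n))) ∉ Set.range fun D => Finset.univ.image (g D) := by
    rintro ⟨D, hD⟩
    have : Finset.univ.image (g D) = ∅ := hD
    rw [Finset.image_eq_empty] at this
    exact absurd (this ▸ Finset.mem_univ (⟨0, hn⟩ : Fin n)) (Finset.notMem_empty _)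
  have := Fintype.card_lt_of_injective_of_notMem _ hinj hne
  rw [Fintype.card_finset, Fintype.card_fin, pow_mul] at this
  rw [Nat.card_eq_fintype_card]
  exact this

/-- The grid `[n]^(r + 2)` is a union of `n ^ r` squares, and a lower set is determined by its
traces on them. -/
lemma card_lowerSet_grid_lt (r : ℕ) {n : ℕ} (hn : 0 < n) :
    Nat.card (LowerSet (Fin (r + 2) → Fin n)) < 4 ^ n ^ (r + 1) := by
  let pt : (Fin r → Fin n) → Fin n × Fin n → Fin (r + 2) → Fin n :=
    fun v p => Fin.cons p.1 (Fin.cons p.2 v)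
  have hpt : ∀ v, Monotone (pt v) := by
    intro v p p' h
    exact Fin.cons_le_cons.2 ⟨h.1, Fin.cons_le_cons.2 ⟨h.2, le_rfl⟩⟩
  let F : LowerSet (Fin (r + 2) → Fin n) → (Fin r → Fin n) → LowerSet (Fin n × Fin n) :=
    fun D v => ⟨{p | pt v p ∈ D}, fun _ _ h hp => D.lower (hpt v h) hp⟩
  have hF : Function.Injective F := by
    intro D E h
    ext x
    have hx : pt (Fin.tail (Fin.tail x)) (x 0, x 1) = x := by
      change Fin.cons (x 0) (Fin.cons (Fin.tail x 0) (Fin.tail (Fin.tail x))) = x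
      rw [Fin.cons_self_tail, Fin.cons_self_tail]
    have h1 := SetLike.ext_iff.1 (congrFun h (Fin.tail (Fin.tail x))) (x 0, x 1)
    change pt _ _ ∈ D ↔ pt _ _ ∈ E at h1
    rwa [hx] at h1
  have hle := Nat.card_le_card_of_injective F hF
  rw [Nat.card_fun] at hle
  simp only [Nat.card_eq_fintype_card (α := Fin r → Fin n), Fintype.card_fun,
    Fintype.card_fin] at hle
  calc _ ≤ _ := hle
    _ < (4 ^ n) ^ n ^ r := Nat.pow_lt_pow_left (card_lowerSet_square_lt hn) (by positivity)
    _ = 4 ^ n ^ (r + 1) := by rw [← pow_mul, ← pow_succ']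

/-! ### Antichains in iterated lattices of lower sets -/

/-- Subsets of an antichain generate lower sets that are ordered like the subsets themselves, so
the middle layer of the Boolean lattice on the antichain survives. -/
lemma exists_antichain_lowerSet {P : Type} [PartialOrder P] {A : Finset P}
    (hA : IsAntichain (· ≤ ·) (A : Set P)) :
    ∃ B : Finset (LowerSet P), IsAntichain (· ≤ ·) (B : Set (LowerSet P)) ∧
      B.card = A.card.choose (A.card / 2) := by
  classical
  have hsub : ∀ S ∈ A.powersetCard (A.card / 2), ∀ T ∈ A.powersetCard (A.card / 2),
      lowerClosure (S : Set P) ≤ lowerClosure (T : Set P) → S = T := by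
    intro S hS T hT hle
    rw [Finset.mem_powersetCard] at hS hT
    refine Finset.eq_of_subset_of_card_le (fun a ha => ?_) (by omega)
    obtain ⟨b, hb, hab⟩ := hle (subset_lowerClosure (show a ∈ (S : Set P) from ha))
    rwa [hA.eq (hS.1 ha) (hT.1 hb) hab]
  refine ⟨(A.powersetCard (A.card / 2)).image fun S : Finset P => lowerClosure (S : Set P),
    ?_, ?_⟩
  · intro s hs t ht hne hle
    rw [Finset.mem_coe, Finset.mem_image] at hs ht
    obtain ⟨S, hS, rfl⟩ := hs
    obtain ⟨T, hT, rfl⟩ := ht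
    exact hne (by rw [hsub S hS T hT hle])
  · rw [Finset.card_image_of_injOn, Finset.card_powersetCard]
    intro S hS T hT h
    exact hsub S hS T hT (le_of_eq h)

lemma linear_le_two_pow {r : ℕ} (hr : 8 ≤ r) : (5 / 4 : ℝ) * (5 * (r + 1) + 1) ≤ 2 ^ r := by
  induction r, hr using Nat.le_induction with
  | base => norm_num
  | succ r hr ih =>
    have : (8 : ℝ) ≤ r := by exact_mod_cast hr
    rw [pow_succ]
    push_cast
    linarith

/-- One step of the recursion for the widths: the loss of a factor `w + 1` against `2 ^ w` in the
middle binomial coefficient is absorbed by the slack factor `5 / 4` in the exponent. -/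
lemma two_rpow_le_choose_middle {w : ℕ} (hw : 40 ≤ w) {s : ℝ} (hs : 5 / 4 * s ≤ w) :
    5 / 4 * (2 : ℝ) ^ s ≤ w.choose (w / 2) := by
  have hw' : (40 : ℝ) ≤ w := by exact_mod_cast hw
  have hsum : (2 : ℝ) ^ w ≤ (w + 1) * w.choose (w / 2) := by
    have : 2 ^ w ≤ (w + 1) * w.choose (w / 2) := by
      rw [← Nat.sum_range_choose]
      refine (Finset.sum_le_card_nsmul _ _ _ fun i _ => Nat.choose_le_middle i w).trans ?_
      simp
    exact_mod_cast this
  have hlin : 5 / 4 * ((w : ℝ) + 1) ≤ (2 : ℝ) ^ ((w : ℝ) / 5) := by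
    have hfl : 8 ≤ ⌊(w : ℝ) / 5⌋₊ := Nat.le_floor (by push_cast; linarith)
    have h1 := linear_le_two_pow hfl
    have h2 := Nat.lt_floor_add_one ((w : ℝ) / 5)
    have h3 : (2 : ℝ) ^ ⌊(w : ℝ) / 5⌋₊ ≤ (2 : ℝ) ^ ((w : ℝ) / 5) := by
      rw [← Real.rpow_natCast]
      exact Real.rpow_le_rpow_of_exponent_le (by norm_num) (Nat.floor_le (by positivity))
    linarith
  have hpos : (0 : ℝ) < (w : ℝ) + 1 := by positivity
  refine le_of_mul_le_mul_left ?_ hpos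
  calc ((w : ℝ) + 1) * (5 / 4 * (2 : ℝ) ^ s) = 5 / 4 * ((w : ℝ) + 1) * (2 : ℝ) ^ s := by ring
    _ ≤ (2 : ℝ) ^ ((w : ℝ) / 5) * (2 : ℝ) ^ (4 / 5 * (w : ℝ)) := by
      gcongr
      · norm_num
      · linarith
    _ = (2 : ℝ) ^ w := by
      rw [← Real.rpow_add two_pos, ← Real.rpow_natCast]
      congr 1
      ring
    _ ≤ _ := hsum

/-- The factor `5 / 4` in the hypothesis on the antichain reproduces itself from each poset to its
lattice of lower sets, and so does the bound `40`. -/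
lemma le_iterLowerSetCard (m : ℕ) {P : Type} [PartialOrder P] [Finite P] {A : Finset P}
    (hA : IsAntichain (· ≤ ·) (A : Set P)) (hcard : 40 ≤ A.card) {s : ℝ} (hs0 : 0 ≤ s)
    (hs : 5 / 4 * s ≤ A.card) :
    (fun y : ℝ => (2 : ℝ) ^ y)^[m] s ≤ iterLowerSetCard m P := by
  induction m generalizing P s with
  | zero =>
    have := Fintype.ofFinite P
    have h1 : (A.card : ℝ) ≤ Nat.card P := by
      rw [Nat.card_eq_fintype_card]
      exact_mod_cast A.card_le_univ
    change s ≤ (Nat.card P : ℝ)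
    linarith
  | succ m ih =>
    obtain ⟨B, hB, hBcard⟩ := exists_antichain_lowerSet hA
    rw [Function.iterate_succ_apply]
    refine ih hB ?_ (by positivity) ?_
    · have := Nat.choose_le_middle 1 A.card
      rw [Nat.choose_one_right] at this
      omega
    · rw [hBcard]
      exact two_rpow_le_choose_middle hcard hs

/-! ### A large layer of the grid -/

/-- Twice the deviation of `v` from the mean of `Fin n`. -/
def deviation {n : ℕ} (v : Fin n) : ℝ := 2 * (v : ℝ) - ((n : ℝ) - 1)

lemma sum_deviation (n : ℕ) : ∑ v : Fin n, deviation v = 0 := by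
  have h : ∀ m : ℕ, ∑ v ∈ Finset.range m, (v : ℝ) = m * (m - 1) / 2 := by
    intro m
    induction m with
    | zero => simp
    | succ m ih => rw [Finset.sum_range_succ, ih]; push_cast; ring
  have h' := (Fin.sum_univ_eq_sum_range (fun v => (v : ℝ)) n).trans (h n)
  simp only [deviation, Finset.sum_sub_distrib, ← Finset.mul_sum, h', Finset.sum_const,
    Finset.card_univ, Fintype.card_fin, nsmul_eq_mul]
  ring

lemma sum_deviation_sq (n : ℕ) :
    ∑ v : Fin n, deviation v ^ 2 = (n : ℝ) * ((n : ℝ) ^ 2 - 1) / 3 := by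
  have h : ∀ (c : ℝ) (m : ℕ), ∑ v ∈ Finset.range m, (2 * (v : ℝ) - c) ^ 2 =
      2 * m * (m - 1) * (2 * m - 1) / 3 - 2 * c * m * (m - 1) + m * c ^ 2 := by
    intro c m
    induction m with
    | zero => simp
    | succ m ih => rw [Finset.sum_range_succ, ih]; push_cast; ring
  have h' := (Fin.sum_univ_eq_sum_range (fun v => (2 * (v : ℝ) - ((n : ℝ) - 1)) ^ 2) n).trans
    (h _ n)
  simp only [deviation, h']
  ring

lemma sum_cons {q n : ℕ} (F : (Fin (q + 1) → Fin n) → ℝ) :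
    ∑ x, F x = ∑ v : Fin n, ∑ x : Fin q → Fin n, F (Fin.cons v x) := by
  rw [← Fintype.sum_prod_type' (f := fun v x => F (Fin.cons v x))]
  exact (Fintype.sum_equiv (Fin.consEquiv fun _ => Fin n) _ _ fun _ => rfl).symm

lemma sum_sum_deviation (q n : ℕ) :
    ∑ x : Fin q → Fin n, ∑ i, deviation (x i) = 0 := by
  induction q with
  | zero => simp
  | succ q ih =>
    rw [sum_cons]
    simp [Fin.sum_univ_succ, Finset.sum_add_distrib, ih, sum_deviation, ← Finset.mul_sum]

/-- The second moment of the centered coordinate sum over the grid. -/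
lemma sum_sum_deviation_sq (q n : ℕ) :
    ∑ x : Fin q → Fin n, (∑ i, deviation (x i)) ^ 2 =
      q * (n : ℝ) ^ q * ((n : ℝ) ^ 2 - 1) / 3 := by
  induction q with
  | zero => simp
  | succ q ih =>
    rw [sum_cons]
    simp only [Fin.sum_univ_succ, Fin.cons_zero, Fin.cons_succ, add_sq, Finset.sum_add_distrib,
      ih, ← Finset.mul_sum, sum_sum_deviation, Finset.sum_const, Finset.card_univ,
      Fintype.card_fin, Fintype.card_fun, nsmul_eq_mul, sum_deviation_sq, mul_zero]
    push_cast
    ring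

/-- By Chebyshev's inequality, two thirds of the points of the grid lie within `√q * n / 2` of the
mean coordinate sum; these are spread over at most `√q * n + 1` layers. -/
lemma exists_large_layer {q n : ℕ} (hq : 0 < q) (hn : 0 < n) :
    ∃ A : Finset (Fin q → Fin n), IsAntichain (· ≤ ·) (A : Set (Fin q → Fin n)) ∧
      2 / 3 * (n : ℝ) ^ q ≤ A.card * (√q * n + 1) := by
  classical
  have hq' : (0 : ℝ) < q := by exact_mod_cast hq
  have hn' : (0 : ℝ) < n := by exact_mod_cast hn
  let dev : (Fin q → Fin n) → ℝ := fun x => ∑ i, deviation (x i)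
  let rank : (Fin q → Fin n) → ℤ := fun x => ∑ i, ((x i : ℕ) : ℤ)
  have hdev : ∀ x, dev x = 2 * (rank x : ℝ) - q * ((n : ℝ) - 1) := by
    intro x
    simp [dev, rank, deviation, Finset.sum_sub_distrib, ← Finset.mul_sum, mul_sub]
  let layer : ℤ → Finset (Fin q → Fin n) := fun s => Finset.univ.filter (rank · = s)
  have hanti : ∀ s, IsAntichain (· ≤ ·) (layer s : Set (Fin q → Fin n)) := by
    intro s x hx y hy hne hle
    simp only [layer, Finset.coe_filter, Finset.mem_univ, true_and, Set.mem_ofPred_eq] at hx hy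
    have hle' : ∀ i ∈ Finset.univ, ((x i : ℕ) : ℤ) ≤ ((y i : ℕ) : ℤ) :=
      fun i _ => by exact_mod_cast hle i
    have h := (Finset.sum_eq_sum_iff_of_le hle').1 (hx.trans hy.symm)
    refine hne (funext fun i => Fin.ext ?_)
    exact_mod_cast h i (Finset.mem_univ i)
  set L : ℝ := √q * n with hL
  have hL0 : 0 < L := by positivity
  have hL2 : L ^ 2 = q * (n : ℝ) ^ 2 := by rw [hL, mul_pow, Real.sq_sqrt hq'.le]
  let T : Finset (Fin q → Fin n) := Finset.univ.filter fun x => |dev x| < L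
  have hT : 2 / 3 * (n : ℝ) ^ q ≤ T.card := by
    have hcheb : ((Tᶜ).card : ℝ) * L ^ 2 ≤ q * (n : ℝ) ^ q * ((n : ℝ) ^ 2 - 1) / 3 := by
      rw [← sum_sum_deviation_sq, ← nsmul_eq_mul]
      refine (Finset.card_nsmul_le_sum Tᶜ (fun x => dev x ^ 2) _ fun x hx => ?_).trans
        (Finset.sum_le_univ_sum_of_nonneg fun x => sq_nonneg _)
      simp only [T, Finset.mem_compl, Finset.mem_filter, Finset.mem_univ, true_and, not_lt] at hx
      rw [← sq_abs (dev x)]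
      gcongr
    have hcompl : ((Tᶜ).card : ℝ) = (n : ℝ) ^ q - T.card := by
      have := Finset.card_add_card_compl T
      rw [Fintype.card_fun, Fintype.card_fin, Fintype.card_fin] at this
      have h : (T.card : ℝ) + (Tᶜ).card = (n : ℝ) ^ q := by exact_mod_cast this
      linarith
    have hle : ((Tᶜ).card : ℝ) ≤ (n : ℝ) ^ q / 3 := by
      refine le_of_mul_le_mul_right (hcheb.trans ?_) (show 0 < L ^ 2 by positivity)
      rw [hL2]
      have : 0 < (q : ℝ) * (n : ℝ) ^ q := by positivity
      nlinarith
    linarith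
  let I : Finset ℤ := Finset.Icc ⌈((q : ℝ) * ((n : ℝ) - 1) - L) / 2⌉
    ⌊((q : ℝ) * ((n : ℝ) - 1) + L) / 2⌋
  have hI : (I.card : ℝ) ≤ L + 1 := by
    have h1 := Int.le_ceil (((q : ℝ) * ((n : ℝ) - 1) - L) / 2)
    have h2 := Int.floor_le (((q : ℝ) * ((n : ℝ) - 1) + L) / 2)
    rw [Int.card_Icc]
    have h3 : ∀ z : ℤ, (z : ℝ) ≤ L + 1 → ((z.toNat : ℕ) : ℝ) ≤ L + 1 := by
      intro z hz
      rcases le_total 0 z with h | h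
      · have : ((z.toNat : ℤ) : ℝ) = z := by rw [Int.toNat_of_nonneg h]
        rw [Int.cast_natCast] at this
        rwa [this]
      · rw [Int.toNat_of_nonpos h]
        push_cast
        linarith
    refine h3 _ ?_
    push_cast
    linarith
  have hmaps : ∀ x ∈ T, rank x ∈ I := by
    intro x hx
    simp only [T, Finset.mem_filter, Finset.mem_univ, true_and, hdev, abs_lt] at hx
    rw [Finset.mem_Icc]
    exact ⟨Int.ceil_le.2 (by linarith [hx.1]), Int.le_floor.2 (by linarith [hx.2])⟩
  by_contra! hcon
  have hsmall : ∀ s, ((layer s).card : ℝ) * (L + 1) < 2 / 3 * (n : ℝ) ^ q :=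
    fun s => hcon (layer s) (hanti s)
  have hTI : (T.card : ℝ) ≤ ∑ s ∈ I, ((layer s).card : ℝ) := by
    rw [Finset.card_eq_sum_card_fiberwise hmaps]
    push_cast
    refine Finset.sum_le_sum fun s _ => ?_
    exact_mod_cast Finset.card_le_card (Finset.filter_subset_filter _ (Finset.subset_univ _))
  have hIne : I.Nonempty := by
    rw [Finset.nonempty_iff_ne_empty]
    intro hIe
    rw [hIe, Finset.sum_empty] at hTI
    have : 0 < (n : ℝ) ^ q := by positivity
    linarith
  have hlt : (∑ s ∈ I, ((layer s).card : ℝ)) * (L + 1) <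
      I.card * (2 / 3 * (n : ℝ) ^ q) := by
    rw [Finset.sum_mul, ← nsmul_eq_mul, ← Finset.sum_const]
    exact Finset.sum_lt_sum_of_nonempty hIne fun s _ => hsmall s
  have h0 : 0 < (n : ℝ) ^ q := by positivity
  have : (T.card : ℝ) * (L + 1) < (L + 1) * (2 / 3 * (n : ℝ) ^ q) :=
    (mul_le_mul_of_nonneg_right hTI (by linarith)).trans_lt
      (hlt.trans_le (mul_le_mul_of_nonneg_right hI (by positivity)))
  nlinarith

/-- The large layer of the grid meets the requirements of `le_iterLowerSetCard` once `128 ≤ n`,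
uniformly in the dimension. -/
lemma exists_antichain_grid (r : ℕ) {n : ℕ} (hn : 128 ≤ n) :
    ∃ A : Finset (Fin (r + 2) → Fin n), IsAntichain (· ≤ ·) (A : Set (Fin (r + 2) → Fin n)) ∧
      40 ≤ A.card ∧ 5 / 4 * ((n : ℝ) ^ (r + 1) / (2 * √((r + 2 : ℕ) : ℝ))) ≤ A.card := by
  obtain ⟨A, hA, hcard⟩ := exists_large_layer (q := r + 2) (n := n) (by omega) (by omega)
  have hn' : (128 : ℝ) ≤ n := by exact_mod_cast hn
  set Q : ℝ := √((r + 2 : ℕ) : ℝ) with hQ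
  have hQ1 : 1 ≤ Q :=
    Real.one_le_sqrt.2 (by push_cast; linarith [(Nat.cast_nonneg r : (0 : ℝ) ≤ r)])
  have hQQ : Q * Q = (r : ℝ) + 2 := by
    rw [hQ, Real.mul_self_sqrt (by positivity)]
    push_cast
    ring
  set p : ℝ := (n : ℝ) ^ (r + 1) with hp
  have hp0 : 0 < p := by positivity
  have hmain : 5 / 4 * (p / (2 * Q)) ≤ A.card := by
    have h1 : 2 / 3 * (p * n) ≤ A.card * (Q * (n + 1)) := by
      rw [hp, ← pow_succ]
      refine hcard.trans (mul_le_mul_of_nonneg_left ?_ (Nat.cast_nonneg _))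
      linarith
    have h2 : 5 / 4 * (p / (2 * Q)) * (Q * (n + 1)) = 5 / 8 * p * (n + 1) := by
      field_simp
      ring
    refine le_of_mul_le_mul_right (a := Q * ((n : ℝ) + 1)) ?_ (by positivity)
    rw [h2]
    nlinarith
  refine ⟨A, hA, ?_, hmain⟩
  have hpow : n * ((r : ℝ) + 2) / 2 ≤ p := by
    have h1 : (r : ℝ) + 1 ≤ 2 ^ r := by exact_mod_cast Nat.lt_two_pow_self (n := r)
    have h2 : (2 : ℝ) ^ r ≤ (n : ℝ) ^ r := by gcongr; linarith
    rw [hp, pow_succ]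
    have h3 : ((r : ℝ) + 2) / 2 ≤ (n : ℝ) ^ r := by
      linarith [(Nat.cast_nonneg r : (0 : ℝ) ≤ r)]
    nlinarith
  have h64 : 64 ≤ p / Q := by
    rw [le_div_iff₀ (by linarith)]
    nlinarith
  have h40 : (40 : ℝ) ≤ A.card := by
    refine le_trans ?_ hmain
    have : p / (2 * Q) = p / Q / 2 := by field_simp
    rw [this]
    linarith
  exact_mod_cast h40

/-! ### Tower bounds for the Ramsey number -/

theorem mainTheorem8 :
    ∃ n₀ : ℕ, ∀ k q n : ℕ, 3 ≤ k → 2 ≤ q → n₀ ≤ n →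
      tower (k - 1) ((n : ℝ) ^ (q - 1) / (2 * Real.sqrt (q : ℝ))) ≤
          (monotonePathRamsey k q n : ℝ) ∧
        (monotonePathRamsey k q n : ℝ) ≤ tower (k - 1) (2 * (n : ℝ) ^ (q - 1)) := by
  refine ⟨128, fun k q n hk hq hn => ?_⟩
  obtain ⟨m, rfl⟩ : ∃ m, k = m + 3 := ⟨k - 3, by omega⟩
  obtain ⟨r, rfl⟩ : ∃ r, q = r + 2 := ⟨q - 2, by omega⟩
  rw [monotonePathRamsey_eq (m + 1) (r + 2) n (by omega)]
  have hexp : r + 2 - 1 = r + 1 := rfl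
  have htower : ∀ x, tower (m + 3 - 1) x = (fun y : ℝ => (2 : ℝ) ^ y)^[m + 1] x := fun _ => rfl
  rw [htower, htower, hexp, Nat.cast_add_one (iterLowerSetCard _ _)]
  constructor
  · obtain ⟨A, hA, h40, hcard⟩ := exists_antichain_grid r hn
    exact (le_iterLowerSetCard (m + 1) hA h40 (by positivity) hcard).trans
      (le_add_of_nonneg_right zero_le_one)
  · rw [Function.iterate_succ_apply]
    refine iterLowerSetCard_add_one_le m (LowerSet (Fin (r + 2) → Fin n)) ?_
    have h1 : Nat.card (LowerSet (Fin (r + 2) → Fin n)) + 1 ≤ 4 ^ n ^ (r + 1) :=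
      card_lowerSet_grid_lt r (by omega)
    have h2 : (2 : ℝ) ^ (2 * (n : ℝ) ^ (r + 1)) = 4 ^ n ^ (r + 1) := by
      rw [Real.rpow_mul (by norm_num), ← Nat.cast_pow, Real.rpow_natCast]
      norm_num
    rw [h2]
    exact_mod_cast h1
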